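/- For $s\in\{0,1\}^n$ let $x\cdot s=\sum_i x_is_i \bmod 2$, and let $P_s$ be the distribution on $\{0,1\}^{n+1}$ with $P_s(x,y)=2^{-n}$ if $y=x\cdot s$ and $P_s(x,y)=0$ otherwise ($x\in\{0,1\}^n$, $y\in\{0,1\}$). A $Z$-basis observable on $N$ qubits is a real diagonal operator in the computational basis of operator norm at most $1$; for example, the Pauli strings $Z^b=Z^{b_1}\otimes\dots\otimes Z^{b_N}$, $b\in\{0,1\}^N$. For a state vector $|\psi\rangle$ let $D_{|\psi\rangle}(z)=|\langle z|\psi\rangle|^2$. **Theorem.** There are Clifford circuits $\mathcal C_s$ on $n+1$ qubits ($n\ge 0$, $s\in\{0,1\}^n$) with clean output states $$|\psi_s\rangle=\mathcal C_s|0\rangle^{\otimes (n+1)}=2^{-n/2}\sum_{x\in\{0,1\}^n}|x,\,x\cdot s\rangle ,\qquad D_{|\psi_s\rangle}=P_s,$$ such that the following holds. For each $n$ let $\mathcal M_n$ be a set of $Z$-basis observables on $n+1$ qubits (for example $\mathcal M_n=\{Z^b\}_{b\in\{0,1\}^{n+1}}$), let $\tau_n>0$, and let $m_n\ge0$ and $k_n\ge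 1$ be integers with $m_n=o(\tau_n^2\,2^n)$ as $n\to\infty$ (the numbers $k_n$ are otherwise arbitrary; in particular $k_n=O(n)$ is allowed). Let $\delta<1$. Then for all sufficiently large $n$ there is no algorithm $\mathcal B$ with the following property: for every $s\in\{0,1\}^n$ and every table of estimates $(\hat o_O)_{O\in\mathcal M_n}$ with $|\hat o_O-\langle\psi_s|O|\psi_s\rangle|<\tau_n$ for all $O\in\mathcal M_n$, the algorithm $\mathcal B$, which is not told $s$ and reads only $m_n$ of these estimates, outputs $k_n$ independent samples from some distribution $p$ on $\{0,1\}^{n+1}$ with $$d_{TV}\big(p,D_{|\psi_s\rangle}\big)\le \tfrac1{16},$$ with probability at least $1-\delta$ over its internal coins. Here $\mathcal B$ is computationally unrestricted, may choose each observable adaptively depending on the estimates read so far, and may be randomized: it first draws (from a discrete distribution) internal coins, over which the success probability is measured and on which $p$ may depend, and may use further discrete randomness for its choice of observables and for its output, the output samples being independent with law $p$ with respect to this further randomness. -/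

import Mathlib

open Filter Asymptotics

namespace WeakToStrong

/-- Bit strings of length `N`; `ZMod 2` gives the inner product modulo 2. -/
abbrev Bits (N : ℕ) : Type := Fin N → ZMod 2

/-- State vectors of `N` qubits, in coordinates with respect to the computational basis. -/
abbrev StateVec (N : ℕ) : Type := Bits N → ℂ

/-- Operators on `N` qubits, as matrices in the computational basis. -/
abbrev Operator (N : ℕ) : Type := Matrix (Bits N) (Bits N) ℂ

/-! ### Clifford circuits -/

/-- The Hadamard matrix. -/
noncomputable def hadamard : Matrix (ZMod 2) (ZMod 2) ℂ :=
  Matrix.of fun a b => (1 / (Real.sqrt 2 : ℂ)) * (-1) ^ (a * b).val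

/-- The phase matrix `diag(1, i)`. -/
noncomputable def phase : Matrix (ZMod 2) (ZMod 2) ℂ :=
  Matrix.diagonal fun a => Complex.I ^ a.val

/-- The operator that applies the one-qubit operator `U` to qubit `i` and the identity to the
other qubits. -/
noncomputable def onQubit {N : ℕ} (i : Fin N) (U : Matrix (ZMod 2) (ZMod 2) ℂ) : Operator N :=
  Matrix.of fun x y => if ∀ j, j ≠ i → x j = y j then U (x i) (y i) else 0

/-- The controlled-NOT gate, `|y⟩ ↦ |y with y_t replaced by y_t + y_c⟩`. -/
noncomputable def cnotMatrix {N : ℕ} (c t : Fin N) : Operator N :=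
  Matrix.of fun x y => if x = Function.update y t (y t + y c) then 1 else 0

/-- The standard generating gates of the Clifford group on `N` qubits. -/
inductive CliffordGate (N : ℕ) : Type
  | H (i : Fin N) : CliffordGate N
  | S (i : Fin N) : CliffordGate N
  | CNOT (c t : Fin N) (h : c ≠ t) : CliffordGate N

/-- The unitary of a Clifford gate. -/
noncomputable def CliffordGate.matrix {N : ℕ} : CliffordGate N → Operator N
  | .H i => onQubit i hadamard
  | .S i => onQubit i phase
  | .CNOT c t _ => cnotMatrix c t

/-- A Clifford circuit: a finite sequence of gates, the head of the list being applied first. -/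
abbrev CliffordCircuit (N : ℕ) : Type := List (CliffordGate N)

/-- The unitary implemented by a Clifford circuit. -/
noncomputable def circuitMatrix {N : ℕ} : CliffordCircuit N → Operator N
  | [] => 1
  | g :: gs => circuitMatrix gs * g.matrix

/-- The clean output state vector `C |0…0⟩`. -/
noncomputable def outputState {N : ℕ} (C : CliffordCircuit N) : StateVec N :=
  Matrix.mulVec (circuitMatrix C) (Pi.single 0 1)

/-! ### Computational basis distribution, expectation values, observables -/

/-- The distribution of the outcome of a computational basis measurement of `ψ`. -/
noncomputable def basisDist {N : ℕ} (ψ : StateVec N) (z : Bits N) : ℝ := ‖ψ z‖ ^ 2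

/-- The expectation value `⟨ψ|O|ψ⟩` (a real number when `O` is Hermitian). -/
noncomputable def expect {N : ℕ} (O : Operator N) (ψ : StateVec N) : ℝ :=
  (dotProduct (star ψ) (Matrix.mulVec O ψ)).re

/-- The `Z`-basis observables: Hermitian operators with the computational basis as eigenbasis
(that is, real diagonal matrices) and operator norm at most one. -/
def zBasisObservables (N : ℕ) : Set (Operator N) :=
  {O | ∃ f : Bits N → ℝ, (∀ z, |f z| ≤ 1) ∧ O = Matrix.diagonal fun z => (f z : ℂ)}

/-- The Pauli matrix `Z`. -/
def pauliZ : Matrix (ZMod 2) (ZMod 2) ℂ := Matrix.diagonal fun a => (-1) ^ a.val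

/-- The Pauli string `Z^b`, the tensor product of the `Z^{b_i}`. -/
noncomputable def pauliZString {N : ℕ} (b : Bits N) : Operator N :=
  Matrix.of fun x y => ∏ i, (pauliZ ^ (b i).val) (x i) (y i)

/-- The strings `Z^b` are among the `Z`-basis observables. -/
theorem range_pauliZString_subset (N : ℕ) :
    Set.range (pauliZString (N := N)) ⊆ zBasisObservables N := by
  rintro _ ⟨b, rfl⟩
  refine ⟨fun z => ∏ i, ((-1 : ℝ) ^ (z i).val) ^ (b i).val, fun z => ?_, ?_⟩
  · rw [Finset.abs_prod]
    simp
  · ext x y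
    simp only [pauliZString, pauliZ, Matrix.of_apply, Matrix.diagonal_pow]
    by_cases h : x = y
    · subst h
      simp
    · obtain ⟨i, hi⟩ := Function.ne_iff.mp h
      rw [Matrix.diagonal_apply_ne _ h]
      exact Finset.prod_eq_zero (Finset.mem_univ i) (Matrix.diagonal_apply_ne _ hi)

/-! ### Parities -/

/-- The parity state `2^{-n/2} ∑ₓ |x, x·s⟩` on `n + 1` qubits. -/
noncomputable def parityState (n : ℕ) (s : Bits n) : StateVec (n + 1) :=
  (1 / (Real.sqrt (2 ^ n) : ℂ)) •
    ∑ x : Bits n, Pi.single (Fin.snoc (α := fun _ => ZMod 2) x (dotProduct x s)) 1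

/-- The parity distribution `P_s` on `n + 1` bits: the first `n` bits `x` are uniform and the
last bit is `x·s`. -/
noncomputable def parityDist (n : ℕ) (s : Bits n) (z : Bits (n + 1)) : ℝ :=
  if z (Fin.last n) = dotProduct (Fin.init z) s then 1 / 2 ^ n else 0

/-! ### Algorithms that see only estimates of expectation values -/

/-- A (possibly randomized) adaptive algorithm that may ask for the estimates of observables in
`𝓜` and has outputs in `α`. The next observable and the output are drawn from distributions that
depend arbitrarily on the list of observables asked and estimates received so far (most recent
first). -/
structure QueryAlgorithm {N : ℕ} (𝓜 : Set (Operator N)) (α : Type) where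
  nextQuery : List (𝓜 × ℝ) → PMF 𝓜
  output : List (𝓜 × ℝ) → PMF α

/-- The law of the output, when the history is `h` and `m` more estimates are asked for, all of
them taken from the table `est` of estimates. -/
noncomputable def QueryAlgorithm.outputLaw {N : ℕ} {𝓜 : Set (Operator N)} {α : Type}
    (A : QueryAlgorithm 𝓜 α) (est : 𝓜 → ℝ) : ℕ → List (𝓜 × ℝ) → PMF α
  | 0, h => A.output h
  | m + 1, h => (A.nextQuery h).bind fun O => A.outputLaw est m ((O, est O) :: h)

/-- A table of `τ`-accurate estimates of the expectation values in the state `ψ`: the output of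
weak error mitigation. -/
def IsAccurate {N : ℕ} {𝓜 : Set (Operator N)} (τ : ℝ) (ψ : StateVec N) (est : 𝓜 → ℝ) : Prop :=
  ∀ O : 𝓜, |est O - expect (O : Operator N) ψ| < τ

/-- Total variation distance of two distributions on a finite set. -/
noncomputable def tvDist {X : Type} [Fintype X] (p q : X → ℝ) : ℝ :=
  (1 / 2) * ∑ x, |p x - q x|

/-- `ν` is the law of `k` independent samples from some distribution `p` whose total variation
distance from `D` is at most `ε`. -/
def IsLawOfSamplesNear {N k : ℕ} (ε : ℝ) (D : Bits N → ℝ) (ν : PMF (Fin k → Bits N)) : Prop :=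
  ∃ p : PMF (Bits N), (∀ z, ν z = ∏ i, p (z i)) ∧ tvDist (fun z => (p z).toReal) D ≤ ε

/-- `B`, an algorithm drawn at random with internal coins, turns `m` adaptively chosen
`τ`-accurate estimates for observables in `𝓜` into `k` independent samples from a distribution
within `ε` of the computational basis distribution, with probability at least `1 - δ` over the
coins. It must do so for every circuit in the class `𝒞` and every table of accurate estimates,
and it knows of the circuit only the estimates it asks for. -/
def SamplesFromEstimates {N k : ℕ} {𝓜 : Set (Operator N)} (𝒞 : Set (CliffordCircuit N))
    (τ ε δ : ℝ) (m : ℕ) (B : PMF (QueryAlgorithm 𝓜 (Fin k → Bits N))) : Prop :=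
  ∀ C ∈ 𝒞, ∀ est : 𝓜 → ℝ, IsAccurate τ (outputState C) est →
    ENNReal.ofReal (1 - δ) ≤ B.toOuterMeasure
      {A | IsLawOfSamplesNear ε (basisDist (outputState C)) (A.outputLaw est m [])}

end WeakToStrong

open WeakToStrong

namespace WeakToStrong

open scoped ENNReal

/-! ### Gates acting on state vectors -/

/-! This is a statistical-query lower bound for parities. The signs χ_s(x, y) = (-1)^(y + x·s) are
pairwise orthogonal and P_s = (1 + χ_s) / 2^(n+1). Hence the expectation of a diagonal observable f
in the parity state differs from its normalized trace by the correlation of f with χ_s, and by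
Bessel at most 1/τ² values of s make this difference τ or more (`card_distinguished_mul_sq_le`).

An adversary answers with the normalized trace whenever that is accurate (`maskedTable`). Compare
this run with the run on normalized traces alone, whose output law μ does not depend on s. Their
output laws differ on any event by at most the expected number of queries that distinguish s, and
these numbers sum to at most m/τ² over all s. All but 8m/τ² values of s therefore have output law
within 1/8 of μ, and μ can serve only one of them (`not_both_samples_near`).

So for fixed coins at most 1 + 8m/τ² parities succeed. Averaging over the coins gives 2^n (1 - δ) ≤
1 + 8m/τ², which fails for large n. -/

theorem circuitMatrix_append {N : ℕ} (C₁ C₂ : CliffordCircuit N) :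
    circuitMatrix (C₁ ++ C₂) = circuitMatrix C₂ * circuitMatrix C₁ := by
  induction C₁ with
  | nil => simp [circuitMatrix]
  | cons g gs ih => simp [circuitMatrix, ih, Matrix.mul_assoc]

theorem onQubit_mulVec {N : ℕ} (i : Fin N) (U : Matrix (ZMod 2) (ZMod 2) ℂ) (ψ : StateVec N)
    (x : Bits N) :
    (onQubit i U).mulVec ψ x = ∑ b, U (x i) b * ψ (Function.update x i b) := by
  have hinj : Function.Injective fun b : ZMod 2 => Function.update x i b :=
    Function.update_injective x i
  simp only [Matrix.mulVec, dotProduct, onQubit, Matrix.of_apply]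
  rw [← Finset.sum_subset (Finset.subset_univ (Finset.univ.map ⟨_, hinj⟩)), Finset.sum_map]
  · refine Finset.sum_congr rfl fun b _ => ?_
    have h : ∀ j, j ≠ i → x j = Function.update x i b j := fun j hj => by simp [hj]
    simp only [Function.Embedding.coeFn_mk, if_pos h, Function.update_self]
  · intro y _ hy
    rw [if_neg, zero_mul]
    intro h
    refine hy (Finset.mem_map.mpr ⟨y i, Finset.mem_univ _, ?_⟩)
    ext j
    by_cases hj : j = i
    · subst hj; simp
    · simp [hj, h j hj]

theorem cnotMatrix_mulVec {N : ℕ} {c t : Fin N} (h : c ≠ t) (ψ : StateVec N) (x : Bits N) :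
    (cnotMatrix c t).mulVec ψ x = ψ (Function.update x t (x t + x c)) := by
  have key : ∀ y : Bits N, x = Function.update y t (y t + y c) ↔
      y = Function.update x t (x t + x c) := by
    -- The gate is an involution on basis strings because c ≠ t leaves the control bit unchanged, so
    -- one implication yields both.
    have aux : ∀ x y : Bits N, x = Function.update y t (y t + y c) →
        y = Function.update x t (x t + x c) := by
      rintro _ y rfl
      ext j
      by_cases hj : j = t
      · subst hj
        simp [h, add_assoc, CharTwo.add_self_eq_zero]
      · simp [hj]
    exact fun y => ⟨aux x y, aux y x⟩
  simp only [Matrix.mulVec, dotProduct, cnotMatrix, Matrix.of_apply, key]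
  simp

/-- The uniform superposition of the basis states supported on the set `S` of qubits. -/
noncomputable def uniformOn {N : ℕ} (S : Finset (Fin N)) : StateVec N :=
  fun z => (1 / (Real.sqrt 2 : ℂ)) ^ S.card * if ∀ i, i ∉ S → z i = 0 then 1 else 0

theorem hadamard_mulVec_uniformOn {N : ℕ} {S : Finset (Fin N)} {i : Fin N} (hi : i ∉ S) :
    (onQubit i hadamard).mulVec (uniformOn S) = uniformOn (insert i S) := by
  ext x
  rw [onQubit_mulVec]
  have h1 : ∀ b : ZMod 2, (∀ j, j ∉ S → Function.update x i b j = 0) ↔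
      (b = 0 ∧ ∀ j, j ∉ insert i S → x j = 0) := by
    intro b
    constructor
    · intro h
      refine ⟨by simpa using h i hi, fun j hj => ?_⟩
      rw [Finset.mem_insert, not_or] at hj
      simpa [hj.1] using h j hj.2
    · rintro ⟨rfl, h⟩ j hj
      by_cases hji : j = i
      · subst hji; simp
      · simpa [hji] using h j (by simp [hji, hj])
  simp only [uniformOn, h1, Finset.card_insert_of_notMem hi]
  rw [Finset.sum_eq_single (0 : ZMod 2)]
  · simp only [hadamard, Matrix.of_apply, mul_zero, ZMod.val_zero, pow_zero, true_and]
    ring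
  · intro b _ hb
    simp [hb]
  · simp

theorem hadamards_mulVec_uniformOn {N : ℕ} (l : List (Fin N)) (S : Finset (Fin N))
    (hl : l.Nodup) (hS : ∀ i ∈ l, i ∉ S) :
    (circuitMatrix (l.map CliffordGate.H)).mulVec (uniformOn S) =
      uniformOn (l.toFinset ∪ S) := by
  induction l generalizing S with
  | nil => simp [circuitMatrix]
  | cons i l ih =>
    rw [List.nodup_cons] at hl
    rw [List.map_cons, circuitMatrix, ← Matrix.mulVec_mulVec]
    simp only [CliffordGate.matrix]
    rw [hadamard_mulVec_uniformOn (hS i (by simp)), ih _ hl.2]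
    · congr 1
      ext j
      simp only [List.mem_toFinset, Finset.mem_union, Finset.mem_insert, List.toFinset_cons]
      tauto
    · intro j hj
      rw [Finset.mem_insert, not_or]
      exact ⟨fun h => hl.1 (h ▸ hj), hS j (by simp [hj])⟩

theorem cnots_mulVec {n : ℕ} (l : List (Fin n)) (ψ : StateVec (n + 1)) :
    (circuitMatrix (l.map fun i =>
        CliffordGate.CNOT i.castSucc (Fin.last n) (Fin.castSucc_lt_last i).ne)).mulVec ψ =
      fun z => ψ (Function.update z (Fin.last n)
        (z (Fin.last n) + (l.map fun i => z i.castSucc).sum)) := by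
  induction l generalizing ψ with
  | nil => simp [circuitMatrix]
  | cons i l ih =>
    rw [List.map_cons, circuitMatrix, ← Matrix.mulVec_mulVec, ih]
    ext z
    simp only [CliffordGate.matrix]
    rw [cnotMatrix_mulVec (Fin.castSucc_lt_last i).ne]
    simp [add_comm, add_left_comm]

/-- The Clifford circuit that prepares the parity state: Hadamard gates on the first `n` qubits,
then controlled-NOT gates from the qubits in the support of `s` to the last one. -/
noncomputable def parityCircuit (n : ℕ) (s : Bits n) : CliffordCircuit (n + 1) :=
  ((Finset.univ.erase (Fin.last n)).toList.map CliffordGate.H) ++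
    ((Finset.univ.filter fun i => s i = 1).toList.map fun i =>
      CliffordGate.CNOT i.castSucc (Fin.last n) (Fin.castSucc_lt_last i).ne)

theorem parityState_apply (n : ℕ) (s : Bits n) (z : Bits (n + 1)) :
    parityState n s z = (1 / (Real.sqrt (2 ^ n) : ℂ)) *
      if z (Fin.last n) = dotProduct (Fin.init z) s then 1 else 0 := by
  rw [parityState, Pi.smul_apply, smul_eq_mul, Finset.sum_apply]
  congr 1
  rw [Finset.sum_eq_single (Fin.init z)]
  · rw [Pi.single_apply]
    refine if_congr ⟨fun h => ?_, fun h => ?_⟩ rfl rfl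
    · conv_lhs => rw [h]
      simp
    · rw [← h, Fin.snoc_init_self]
  · intro x _ hx
    rw [Pi.single_apply, if_neg]
    rintro rfl
    exact hx (by simp)
  · simp

theorem outputState_parityCircuit (n : ℕ) (s : Bits n) :
    outputState (parityCircuit n s) = parityState n s := by
  have h0 : (Pi.single 0 1 : StateVec (n + 1)) = uniformOn ∅ := by
    ext z
    simp only [uniformOn, Pi.single_apply, funext_iff]
    simp
  rw [outputState, parityCircuit, circuitMatrix_append, ← Matrix.mulVec_mulVec, h0,
    hadamards_mulVec_uniformOn _ _ (Finset.nodup_toList _) (by simp), cnots_mulVec]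
  ext z
  rw [parityState_apply]
  have hsum : ((Finset.univ.filter fun i => s i = 1).toList.map fun i => z i.castSucc).sum =
      dotProduct (Fin.init z) s := by
    rw [Finset.sum_map_toList, Finset.sum_filter, dotProduct]
    refine Finset.sum_congr rfl fun i _ => ?_
    rcases (by decide : ∀ a : ZMod 2, a = 0 ∨ a = 1) (s i) with h | h <;> simp [h, Fin.init]
  -- After the Hadamards only strings with last bit 0 have nonzero amplitude; pulled back through
  -- the CNOTs, this is the parity constraint.
  have hcond : (∀ i : Fin (n + 1), i = Fin.last n → Function.update z (Fin.last n)
      (z (Fin.last n) + dotProduct (Fin.init z) s) i = 0) ↔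
      z (Fin.last n) = dotProduct (Fin.init z) s := by
    rw [forall_eq, Function.update_self, CharTwo.add_eq_zero]
  simp only [hsum, uniformOn, Finset.union_empty, Finset.toList_toFinset, Finset.mem_erase,
    Finset.mem_univ, and_true, not_not, hcond, Finset.card_erase_of_mem, Finset.card_univ,
    Fintype.card_fin, Nat.add_sub_cancel]
  congr 1
  rw [Real.sqrt_eq_rpow, Real.sqrt_eq_rpow, ← Real.rpow_natCast_mul (by norm_num), mul_comm,
    Real.rpow_mul_natCast (by norm_num)]
  push_cast
  simp

theorem basisDist_parityState (n : ℕ) (s : Bits n) :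
    basisDist (parityState n s) = parityDist n s := by
  ext z
  rw [basisDist, parityState_apply, parityDist]
  split_ifs
  · simp [Real.sq_sqrt]
  · simp

/-! ### Parity signs -/

/-- The character of the group of two elements. -/
def bitSign (a : ZMod 2) : ℝ := (-1) ^ a.val

theorem bitSign_zero : bitSign 0 = 1 := by simp [bitSign]

theorem bitSign_one : bitSign 1 = -1 := by simp [bitSign, ZMod.val_one]

theorem bitSign_add (a b : ZMod 2) : bitSign (a + b) = bitSign a * bitSign b := by
  have h : ∀ a : ZMod 2, a = 0 ∨ a = 1 := by decide
  rcases h a with rfl | rfl <;> rcases h b with rfl | rfl <;>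
    simp [bitSign_zero, bitSign_one, CharTwo.add_self_eq_zero]

theorem sum_bitSign_dotProduct {N : ℕ} {t : Bits N} (ht : t ≠ 0) :
    ∑ z : Bits N, bitSign (dotProduct z t) = 0 := by
  obtain ⟨i, hi⟩ := Function.ne_iff.mp ht
  have hi1 : t i = 1 := (by decide : ∀ a : ZMod 2, a ≠ 0 → a = 1) _ hi
  -- Flipping a bit where t is 1 negates every term, so the sum equals its own negative.
  have h := Equiv.sum_comp (Equiv.addRight (Pi.single i 1 : Bits N))
    fun z => bitSign (dotProduct z t)
  simp only [Equiv.coe_addRight, add_dotProduct, single_dotProduct, hi1, mul_one, bitSign_add,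
    bitSign_one, mul_neg, Finset.sum_neg_distrib] at h
  linarith

/-- The sign of the parity constraint `y = x·s` at the string `z = (x, y)`. -/
def paritySign {n : ℕ} (s : Bits n) (z : Bits (n + 1)) : ℝ :=
  bitSign (z (Fin.last n) + dotProduct (Fin.init z) s)

/-- Makes each parity sign a character of the full group of n + 1 bits. The appended 1 keeps the
character nontrivial even for s = 0. -/
theorem paritySign_eq {n : ℕ} (s : Bits n) (z : Bits (n + 1)) :
    paritySign s z = bitSign (dotProduct z (Fin.snoc (α := fun _ => ZMod 2) s 1)) := by
  simp [paritySign, dotProduct, Fin.sum_univ_castSucc, Fin.init, add_comm]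

theorem paritySign_of_eq {n : ℕ} {s : Bits n} {z : Bits (n + 1)}
    (h : z (Fin.last n) = dotProduct (Fin.init z) s) : paritySign s z = 1 := by
  rw [paritySign, h, CharTwo.add_self_eq_zero, bitSign_zero]

theorem paritySign_of_ne {n : ℕ} {s : Bits n} {z : Bits (n + 1)}
    (h : z (Fin.last n) ≠ dotProduct (Fin.init z) s) : paritySign s z = -1 := by
  rw [paritySign, (by decide : ∀ a b : ZMod 2, a ≠ b → a + b = 1) _ _ h, bitSign_one]

theorem paritySign_mul_self {n : ℕ} (s : Bits n) (z : Bits (n + 1)) :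
    paritySign s z * paritySign s z = 1 := by
  rw [paritySign, ← bitSign_add, CharTwo.add_self_eq_zero, bitSign_zero]

theorem sum_paritySign {n : ℕ} (s : Bits n) : ∑ z, paritySign s z = 0 := by
  simp only [paritySign_eq]
  refine sum_bitSign_dotProduct fun h => ?_
  have := congrFun h (Fin.last n)
  simp at this

theorem sum_paritySign_mul {n : ℕ} {s t : Bits n} (hst : s ≠ t) :
    ∑ z, paritySign s z * paritySign t z = 0 := by
  simp only [paritySign_eq, ← bitSign_add, ← dotProduct_add]
  refine sum_bitSign_dotProduct fun h => hst ?_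
  ext i
  have := congrFun h i.castSucc
  simpa [CharTwo.add_eq_zero] using this

theorem sum_paritySign_mul_self {n : ℕ} (s : Bits n) :
    ∑ z, paritySign s z * paritySign s z = 2 ^ (n + 1) := by
  simp [paritySign_mul_self]

theorem parityDist_eq {n : ℕ} (s : Bits n) (z : Bits (n + 1)) :
    parityDist n s z = (1 + paritySign s z) / 2 ^ (n + 1) := by
  rw [parityDist]
  split_ifs with h
  · rw [paritySign_of_eq h, pow_succ]
    field_simp
    norm_num
  · rw [paritySign_of_ne h]
    simp

/-- The strings that satisfy the parity constraint `y = x·s`. -/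
def paritySet {n : ℕ} (s : Bits n) : Set (Bits (n + 1)) :=
  {z | z (Fin.last n) = dotProduct (Fin.init z) s}

theorem indicator_paritySet {n : ℕ} (s : Bits n) (z : Bits (n + 1)) :
    (paritySet s).indicator 1 z = (1 + paritySign s z) / 2 := by
  by_cases h : z ∈ paritySet s
  · rw [Set.indicator_of_mem h, paritySign_of_eq h]
    norm_num
  · rw [Set.indicator_of_notMem h, paritySign_of_ne h]
    norm_num

theorem sum_parityDist_paritySet {n : ℕ} (s : Bits n) :
    ∑ z, (paritySet s).indicator (parityDist n s) z = 1 := by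
  have h : ∀ z, (paritySet s).indicator (parityDist n s) z =
      (1 + paritySign s z) * (1 / 2 ^ (n + 1)) := fun z => by
    rw [Set.indicator_eq_self.mpr, parityDist_eq]
    · ring
    · intro z hz
      by_contra hc
      exact hz (if_neg hc)
  simp_rw [h]
  rw [← Finset.sum_mul, Finset.sum_add_distrib, sum_paritySign]
  simp

/-- The indicator is (1 - χ_t) / 2 and the density is (1 + χ_s) / 2^(n+1); in their product only the
constant term survives summation. -/
theorem sum_parityDist_compl_paritySet {n : ℕ} {s t : Bits n} (hst : s ≠ t) :
    ∑ z, (paritySet t)ᶜ.indicator (parityDist n s) z = 1 / 2 := by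
  have h : ∀ z, (paritySet t)ᶜ.indicator (parityDist n s) z =
      (1 + paritySign s z - paritySign t z - paritySign s z * paritySign t z) *
        (1 / 2 ^ (n + 2)) := fun z => by
    have h1 : (paritySet t)ᶜ.indicator (parityDist n s) z =
        (1 - (paritySet t).indicator 1 z) * parityDist n s z := by
      by_cases hz : z ∈ paritySet t <;> simp [hz]
    rw [h1, indicator_paritySet, parityDist_eq, pow_succ 2 (n + 1)]
    field_simp
    ring
  simp_rw [h]
  rw [← Finset.sum_mul, Finset.sum_sub_distrib, Finset.sum_sub_distrib, Finset.sum_add_distrib,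
    sum_paritySign, sum_paritySign, sum_paritySign_mul hst]
  simp [pow_succ]
  field_simp

/-! ### Expectation values of diagonal observables -/

/-- The normalized trace of an observable: its expectation in the maximally mixed state. -/
noncomputable def normalizedTrace {N : ℕ} (O : Operator N) : ℝ :=
  (∑ z, (O z z).re) / 2 ^ N

theorem expect_diagonal {N : ℕ} (f : Bits N → ℝ) (ψ : StateVec N) :
    expect (Matrix.diagonal fun z => (f z : ℂ)) ψ = ∑ z, f z * basisDist ψ z := by
  simp only [expect, dotProduct, Matrix.mulVec_diagonal, Complex.re_sum, basisDist]
  refine Finset.sum_congr rfl fun z _ => ?_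
  rw [← Complex.normSq_eq_norm_sq, Complex.normSq_apply]
  simp
  ring

theorem normalizedTrace_sub_expect_parityState {n : ℕ} (f : Bits (n + 1) → ℝ) (s : Bits n) :
    normalizedTrace (Matrix.diagonal fun z => (f z : ℂ)) -
      expect (Matrix.diagonal fun z => (f z : ℂ)) (parityState n s) =
      -((∑ z, f z * paritySign s z) / 2 ^ (n + 1)) := by
  rw [expect_diagonal, basisDist_parityState, normalizedTrace]
  simp only [Matrix.diagonal_apply_eq, Complex.ofReal_re, parityDist_eq, Finset.sum_div]
  rw [← Finset.sum_sub_distrib, ← Finset.sum_neg_distrib]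
  refine Finset.sum_congr rfl fun z _ => ?_
  ring

/-- Bessel's inequality for the parity signs. -/
theorem sum_sq_parityCoeff_le {n : ℕ} (f : Bits (n + 1) → ℝ) :
    ∑ s, ((∑ z, f z * paritySign s z) / 2 ^ (n + 1)) ^ 2 ≤ (∑ z, f z ^ 2) / 2 ^ (n + 1) := by
  set c : Bits n → ℝ := fun s => (∑ z, f z * paritySign s z) / 2 ^ (n + 1) with hc
  have hpos : (0 : ℝ) < 2 ^ (n + 1) := by positivity
  have hcs : ∀ s, ∑ z, f z * paritySign s z = 2 ^ (n + 1) * c s := fun s => by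
    rw [hc]; field_simp
  have h1 : ∑ z, f z * ∑ s, c s * paritySign s z = 2 ^ (n + 1) * ∑ s, c s ^ 2 := by
    simp_rw [Finset.mul_sum]
    rw [Finset.sum_comm]
    refine Finset.sum_congr rfl fun s _ => ?_
    calc ∑ z, f z * (c s * paritySign s z) = c s * ∑ z, f z * paritySign s z := by
          rw [Finset.mul_sum]; exact Finset.sum_congr rfl fun z _ => by ring
      _ = _ := by rw [hcs]; ring
  have h2 : ∑ z, (∑ s, c s * paritySign s z) * ∑ s, c s * paritySign s z =
      2 ^ (n + 1) * ∑ s, c s ^ 2 := by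
    simp_rw [Finset.sum_mul_sum]
    rw [Finset.sum_comm, Finset.mul_sum]
    refine Finset.sum_congr rfl fun s _ => ?_
    rw [Finset.sum_comm, Finset.sum_eq_single s]
    · calc ∑ z, c s * paritySign s z * (c s * paritySign s z)
          = c s ^ 2 * ∑ z, paritySign s z * paritySign s z := by
            rw [Finset.mul_sum]; exact Finset.sum_congr rfl fun z _ => by ring
        _ = _ := by rw [sum_paritySign_mul_self]; ring
    · intro t _ hts
      calc ∑ z, c s * paritySign s z * (c t * paritySign t z)
          = c s * c t * ∑ z, paritySign s z * paritySign t z := by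
            rw [Finset.mul_sum]; exact Finset.sum_congr rfl fun z _ => by ring
        _ = 0 := by rw [sum_paritySign_mul hts.symm, mul_zero]
    · simp
  -- Bessel: the residual of the projection onto the signs has nonnegative squared norm.
  have h3 : 0 ≤ ∑ z, (f z - ∑ s, c s * paritySign s z) ^ 2 :=
    Finset.sum_nonneg fun z _ => sq_nonneg _
  have h4 : ∑ z, (f z - ∑ s, c s * paritySign s z) ^ 2 = ∑ z, f z ^ 2 -
      2 * (∑ z, f z * ∑ s, c s * paritySign s z) +
      ∑ z, (∑ s, c s * paritySign s z) * ∑ s, c s * paritySign s z := by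
    rw [Finset.mul_sum, ← Finset.sum_sub_distrib, ← Finset.sum_add_distrib]
    exact Finset.sum_congr rfl fun z _ => by ring
  rw [le_div_iff₀ hpos]
  rw [h4, h1, h2] at h3
  linarith

open Classical in
/-- At most `1 / τ ^ 2` parity states can be told apart from the maximally mixed state by a
`τ`-accurate estimate of a given `Z`-basis observable. -/
theorem card_distinguished_mul_sq_le {n : ℕ} {τ : ℝ} (hτ : 0 < τ) {O : Operator (n + 1)}
    (hO : O ∈ zBasisObservables (n + 1)) :
    ((Finset.univ.filter fun s : Bits n =>
      τ ≤ |normalizedTrace O - expect O (parityState n s)|).card : ℝ) * τ ^ 2 ≤ 1 := by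
  obtain ⟨f, hf, rfl⟩ := hO
  have hf1 : (∑ z, f z ^ 2) / 2 ^ (n + 1) ≤ 1 := by
    rw [div_le_one (by positivity)]
    calc ∑ z, f z ^ 2 ≤ ∑ _z : Bits (n + 1), (1 : ℝ) :=
          Finset.sum_le_sum fun z _ => (sq_le_one_iff_abs_le_one _).mpr (hf z)
      _ = 2 ^ (n + 1) := by simp
  refine le_trans ?_ ((sum_sq_parityCoeff_le f).trans hf1)
  rw [← nsmul_eq_mul, ← Finset.sum_const]
  refine (Finset.sum_le_sum fun s hs => ?_).trans
    (Finset.sum_le_sum_of_subset_of_nonneg (Finset.filter_subset _ _) fun s _ _ => sq_nonneg _)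
  have h := (Finset.mem_filter.mp hs).2
  rw [normalizedTrace_sub_expect_parityState, abs_neg] at h
  rw [← sq_abs (_ / _)]
  exact pow_le_pow_left₀ hτ.le h 2

/-! ### Adaptive algorithms and tables of estimates -/

theorem toOuterMeasure_le_one {α : Type*} (p : PMF α) (T : Set α) : p.toOuterMeasure T ≤ 1 := by
  rw [PMF.toOuterMeasure_apply, ← p.tsum_coe]
  exact ENNReal.tsum_le_tsum fun a => Set.indicator_le_self T p a

theorem toOuterMeasure_ne_top {α : Type*} (p : PMF α) (T : Set α) : p.toOuterMeasure T ≠ ∞ :=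
  ((toOuterMeasure_le_one p T).trans_lt ENNReal.one_lt_top).ne

theorem toOuterMeasure_add_compl {α : Type*} (p : PMF α) (T : Set α) :
    p.toOuterMeasure T + p.toOuterMeasure Tᶜ = 1 := by
  rw [PMF.toOuterMeasure_apply, PMF.toOuterMeasure_apply, ← ENNReal.tsum_add, ← p.tsum_coe]
  exact tsum_congr fun a => Set.indicator_self_add_compl_apply T p a

/-- The expected number of queries in the set `bad`, when `m` more estimates are asked for. -/
noncomputable def QueryAlgorithm.expectedHits {N : ℕ} {𝓜 : Set (Operator N)} {α : Type}
    (A : QueryAlgorithm 𝓜 α) (est : 𝓜 → ℝ) (bad : Set 𝓜) : ℕ → List (𝓜 × ℝ) → ℝ≥0∞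
  | 0, _ => 0
  | m + 1, h => ∑' O, A.nextQuery h O *
      (bad.indicator 1 O + A.expectedHits est bad m ((O, est O) :: h))

/-- If two tables agree outside `bad`, passing from one to the other raises the probability of an
output event by at most the expected number of queries in `bad`. -/
theorem QueryAlgorithm.outputLaw_le_add_expectedHits {N : ℕ} {𝓜 : Set (Operator N)} {α : Type}
    (A : QueryAlgorithm 𝓜 α) {e e' : 𝓜 → ℝ} {bad : Set 𝓜} (hee : ∀ O, O ∉ bad → e' O = e O)
    (T : Set α) (m : ℕ) (h : List (𝓜 × ℝ)) :
    (A.outputLaw e' m h).toOuterMeasure T ≤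
      (A.outputLaw e m h).toOuterMeasure T + A.expectedHits e bad m h := by
  induction m generalizing h with
  | zero => simp [outputLaw, expectedHits]
  | succ m ih =>
    simp only [outputLaw, expectedHits, PMF.toOuterMeasure_bind_apply]
    rw [← ENNReal.tsum_add]
    refine ENNReal.tsum_le_tsum fun O => ?_
    rw [← mul_add]
    gcongr
    -- A bad query already contributes 1 to the hit count, which dominates any probability;
    -- otherwise both runs receive the same answer and the induction continues.
    by_cases hO : O ∈ bad
    · rw [Set.indicator_of_mem hO, Pi.one_apply]
      refine (toOuterMeasure_le_one _ _).trans ?_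
      rw [add_left_comm]
      exact le_self_add
    · rw [Set.indicator_of_notMem hO, zero_add, hee O hO]
      exact ih _

/-- The table `e` is the same for all indices, so all the counts refer to one random run, in which
each query lies in at most K of the bad sets. -/
theorem QueryAlgorithm.sum_expectedHits_le {N : ℕ} {𝓜 : Set (Operator N)} {α ι : Type}
    [Fintype ι] (A : QueryAlgorithm 𝓜 α) (e : 𝓜 → ℝ) {bad : ι → Set 𝓜} {K : ℝ≥0∞}
    (hK : ∀ O, ∑ s, (bad s).indicator 1 O ≤ K) (m : ℕ) (h : List (𝓜 × ℝ)) :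
    ∑ s, A.expectedHits e (bad s) m h ≤ m * K := by
  induction m generalizing h with
  | zero => simp [expectedHits]
  | succ m ih =>
    simp only [expectedHits]
    rw [← Summable.tsum_finsetSum fun _ _ => ENNReal.summable]
    calc ∑' O, ∑ s, A.nextQuery h O *
          ((bad s).indicator 1 O + A.expectedHits e (bad s) m ((O, e O) :: h))
        ≤ ∑' O, A.nextQuery h O * (K + m * K) := by
          refine ENNReal.tsum_le_tsum fun O => ?_
          rw [← Finset.mul_sum, Finset.sum_add_distrib]
          gcongr
          · exact hK O
          · exact ih _
      _ = (m + 1 : ℕ) * K := by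
          rw [ENNReal.tsum_mul_right, PMF.tsum_coe]
          push_cast
          ring

/-! ### Laws of independent samples -/

theorem toOuterMeasure_coordinate {X : Type} [Fintype X] {k : ℕ} {p : PMF X}
    {ν : PMF (Fin k → X)} (hν : ∀ z, ν z = ∏ i, p (z i)) (i₀ : Fin k) (T : Set X) :
    ν.toOuterMeasure {z | z i₀ ∈ T} = p.toOuterMeasure T := by
  classical
  -- Restrict to T at coordinate i₀ only; the other factors sum to 1.
  let f : Fin k → X → ℝ≥0∞ := fun i => if i = i₀ then T.indicator p else p
  have hprod : ∏ i, ∑ x, f i x = p.toOuterMeasure T := by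
    rw [Finset.prod_eq_single i₀]
    · simp [f, PMF.toOuterMeasure_apply_fintype]
    · intro i _ hi
      simp only [f, if_neg hi]
      rw [← tsum_fintype (L := .unconditional X), p.tsum_coe]
    · simp
  rw [PMF.toOuterMeasure_apply_fintype, ← hprod, Finset.prod_univ_sum, Fintype.piFinset_univ]
  refine Finset.sum_congr rfl fun z _ => ?_
  by_cases hz : z i₀ ∈ T
  · rw [Set.indicator_of_mem (by exact hz), hν]
    refine Finset.prod_congr rfl fun i _ => ?_
    by_cases hi : i = i₀
    · subst hi; simp [f, hz]
    · simp [f, hi]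
  · rw [Set.indicator_of_notMem (by exact hz)]
    exact (Finset.prod_eq_zero (Finset.mem_univ i₀) (by simp [f, hz])).symm

/-- The error is bounded by the whole ℓ¹ distance, hence 2ε; D need not be normalized. A single
sample is enough, so k plays no role. -/
theorem IsLawOfSamplesNear.sum_indicator_le {N k : ℕ} {ε : ℝ} {D : Bits N → ℝ}
    {ν : PMF (Fin k → Bits N)} (h : IsLawOfSamplesNear ε D ν) (i₀ : Fin k) (T : Set (Bits N)) :
    ∑ z, T.indicator D z ≤ (ν.toOuterMeasure {z | z i₀ ∈ T}).toReal + 2 * ε := by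
  obtain ⟨p, hν, hp⟩ := h
  rw [toOuterMeasure_coordinate hν, PMF.toOuterMeasure_apply_fintype, ENNReal.toReal_sum]
  · rw [tvDist] at hp
    have hle : ∑ z, T.indicator D z ≤
        ∑ z, (T.indicator p z).toReal + ∑ z, |(p z).toReal - D z| := by
      rw [← Finset.sum_add_distrib]
      refine Finset.sum_le_sum fun z _ => ?_
      by_cases hz : z ∈ T
      · rw [Set.indicator_of_mem hz, Set.indicator_of_mem hz]
        linarith [neg_abs_le ((p z).toReal - D z)]
      · simp [hz]
    linarith
  · intro z _
    exact ((Set.indicator_le_self T p z).trans_lt (p.apply_lt_top z)).ne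

/-! ### The lower bound -/

/-- Laws of samples for two different parities cannot both be close to the same law. -/
theorem not_both_samples_near {n k : ℕ} (i₀ : Fin k) {s t : Bits n} (hst : s ≠ t)
    {μ ν ν' : PMF (Fin k → Bits (n + 1))} {a b : ℝ≥0∞} (ha : a < 1 / 8) (hb : b < 1 / 8)
    (hν : IsLawOfSamplesNear (1 / 16) (parityDist n s) ν)
    (hν' : IsLawOfSamplesNear (1 / 16) (parityDist n t) ν')
    (hνμ : ∀ T, ν.toOuterMeasure T ≤ μ.toOuterMeasure T + a)
    (hνμ' : ∀ T, ν'.toOuterMeasure T ≤ μ.toOuterMeasure T + b) : False := by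
  have key : ∀ {ρ : PMF (Fin k → Bits (n + 1))} {c : ℝ≥0∞}, c < 1 / 8 →
      (∀ T, ρ.toOuterMeasure T ≤ μ.toOuterMeasure T + c) → ∀ T,
      (ρ.toOuterMeasure T).toReal < (μ.toOuterMeasure T).toReal + 1 / 8 := by
    intro ρ c hc hρ T
    have hctop : c ≠ ∞ := (hc.trans_le le_top).ne
    have hc8 : c.toReal < 1 / 8 := by
      have := (ENNReal.toReal_lt_toReal hctop (by simp)).mpr hc
      simpa using this
    have h := ENNReal.toReal_mono
      (ENNReal.add_ne_top.mpr ⟨toOuterMeasure_ne_top μ T, hctop⟩) (hρ T)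
    rw [ENNReal.toReal_add (toOuterMeasure_ne_top μ T) hctop] at h
    linarith
  -- The test event gives 1/2 + 1 on the left. On the right stand the total mass 1 of μ, twice 2/16
  -- for sampling error, and two transfer errors strictly below 1/8: a strict contradiction.
  have h1 := hν.sum_indicator_le i₀ (paritySet t)ᶜ
  have h2 := hν'.sum_indicator_le i₀ (paritySet t)
  rw [sum_parityDist_compl_paritySet hst] at h1
  rw [sum_parityDist_paritySet] at h2
  have h3 := key ha hνμ {z | z i₀ ∈ (paritySet t)ᶜ}
  have h4 := key hb hνμ' {z | z i₀ ∈ paritySet t}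
  have h5 := congrArg ENNReal.toReal (toOuterMeasure_add_compl μ {z | z i₀ ∈ paritySet t})
  rw [ENNReal.toReal_add (toOuterMeasure_ne_top _ _) (toOuterMeasure_ne_top _ _),
    ENNReal.toReal_one] at h5
  have h6 : {z : Fin k → Bits (n + 1) | z i₀ ∈ paritySet t}ᶜ = {z | z i₀ ∈ (paritySet t)ᶜ} := rfl
  rw [h6] at h5
  linarith

open Classical in
/-- The table of estimates that agrees with the maximally mixed state wherever this is
`τ`-accurate, and is exact elsewhere. -/
noncomputable def maskedTable {N : ℕ} (𝓜 : Set (Operator N)) (τ : ℝ) (ψ : StateVec N) (O : 𝓜) : ℝ :=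
  if |normalizedTrace (O : Operator N) - expect (O : Operator N) ψ| < τ then
    normalizedTrace (O : Operator N) else expect (O : Operator N) ψ

theorem isAccurate_maskedTable {N : ℕ} (𝓜 : Set (Operator N)) {τ : ℝ} (hτ : 0 < τ)
    (ψ : StateVec N) : IsAccurate τ ψ (maskedTable 𝓜 τ ψ) := by
  intro O
  rw [maskedTable]
  split_ifs with h
  · exact h
  · simpa using hτ

/-- The observables whose expectation value in `ψ` is not within `τ` of the normalized trace. -/
def distinguishing {N : ℕ} (𝓜 : Set (Operator N)) (τ : ℝ) (ψ : StateVec N) : Set 𝓜 :=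
  {O | τ ≤ |normalizedTrace (O : Operator N) - expect (O : Operator N) ψ|}

theorem maskedTable_of_notMem {N : ℕ} {𝓜 : Set (Operator N)} {τ : ℝ} {ψ : StateVec N} {O : 𝓜}
    (h : O ∉ distinguishing 𝓜 τ ψ) :
    maskedTable 𝓜 τ ψ O = normalizedTrace (O : Operator N) :=
  if_pos (not_le.mp h)

theorem sum_indicator_distinguishing_le {n : ℕ} {𝓜 : Set (Operator (n + 1))} {τ : ℝ}
    (hτ : 0 < τ) (h𝓜 : 𝓜 ⊆ zBasisObservables (n + 1)) (O : 𝓜) :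
    ∑ s, (distinguishing 𝓜 τ (parityState n s)).indicator (1 : 𝓜 → ℝ≥0∞) O ≤
      ENNReal.ofReal (1 / τ ^ 2) := by
  classical
  have h := card_distinguished_mul_sq_le hτ (h𝓜 O.2)
  rw [← le_div_iff₀ (by positivity)] at h
  refine le_trans (le_of_eq ?_) (ENNReal.ofReal_le_ofReal h)
  rw [ENNReal.ofReal_natCast, Finset.card_filter, Nat.cast_sum]
  refine Finset.sum_congr rfl fun s _ => ?_
  simp [Set.indicator_apply, distinguishing]

open Classical in
/-- An algorithm succeeds for few parities. -/
theorem sum_success_le {n k m : ℕ} (hk : 1 ≤ k) {τ : ℝ} (hτ : 0 < τ)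
    {𝓜 : Set (Operator (n + 1))} (h𝓜 : 𝓜 ⊆ zBasisObservables (n + 1))
    (A : QueryAlgorithm 𝓜 (Fin k → Bits (n + 1))) :
    (∑ s : Bits n, if IsLawOfSamplesNear (1 / 16) (parityDist n s)
        (A.outputLaw (maskedTable 𝓜 τ (parityState n s)) m []) then (1 : ℝ≥0∞) else 0) ≤
      1 + 8 * (m * ENNReal.ofReal (1 / τ ^ 2)) := by
  set e : 𝓜 → ℝ := fun O => normalizedTrace (O : Operator (n + 1))
  set hits : Bits n → ℝ≥0∞ := fun s =>
    A.expectedHits e (distinguishing 𝓜 τ (parityState n s)) m []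
  set success : Bits n → Prop := fun s => IsLawOfSamplesNear (1 / 16) (parityDist n s)
    (A.outputLaw (maskedTable 𝓜 τ (parityState n s)) m [])
  have hclose : ∀ s T, (A.outputLaw (maskedTable 𝓜 τ (parityState n s)) m []).toOuterMeasure T ≤
      (A.outputLaw e m []).toOuterMeasure T + hits s := fun s T =>
    A.outputLaw_le_add_expectedHits (fun O hO => maskedTable_of_notMem hO) T m []
  have hcard : (Finset.univ.filter fun s => success s ∧ hits s < 1 / 8).card ≤ 1 := by
    rw [Finset.card_le_one]
    intro s hs t ht
    rw [Finset.mem_filter] at hs ht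
    by_contra hst
    exact not_both_samples_near ⟨0, hk⟩ hst hs.2.2 ht.2.2 hs.2.1 ht.2.1 (hclose s) (hclose t)
  calc ∑ s, (if success s then (1 : ℝ≥0∞) else 0)
      ≤ ∑ s, ((if success s ∧ hits s < 1 / 8 then (1 : ℝ≥0∞) else 0) + 8 * hits s) := by
        refine Finset.sum_le_sum fun s _ => ?_
        by_cases h1 : success s
        · by_cases h2 : hits s < 1 / 8
          · rw [if_pos h1, if_pos ⟨h1, h2⟩]
            exact le_self_add
          -- As in Markov's inequality, at least 1/8 expected hits pay for the success, whence the
          -- factor 8.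
          · rw [if_pos h1, if_neg (fun h => h2 h.2), zero_add]
            calc (1 : ℝ≥0∞) = 8 * (1 / 8) := by
                  rw [one_div, ENNReal.mul_inv_cancel (by norm_num) (by norm_num)]
              _ ≤ 8 * hits s := by gcongr; exact not_lt.mp h2
        · simp [h1]
    _ = ((Finset.univ.filter fun s => success s ∧ hits s < 1 / 8).card : ℝ≥0∞) +
          8 * ∑ s, hits s := by
        rw [Finset.sum_add_distrib, Finset.mul_sum, Finset.card_filter]
        push_cast
        rfl
    _ ≤ _ := by
        gcongr
        · exact_mod_cast hcard
        · exact A.sum_expectedHits_le e (sum_indicator_distinguishing_le hτ h𝓜) m []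

/-- The masked table is admissible for every s, so the success guarantee can be summed over s and
exchanged with the average over coins. -/
theorem SamplesFromEstimates.query_bound {n k m : ℕ} (hk : 1 ≤ k) {τ δ : ℝ} (hτ : 0 < τ)
    (hδ : δ < 1) {𝓜 : Set (Operator (n + 1))} (h𝓜 : 𝓜 ⊆ zBasisObservables (n + 1))
    {B : PMF (QueryAlgorithm 𝓜 (Fin k → Bits (n + 1)))}
    (hB : SamplesFromEstimates (Set.range (parityCircuit n)) τ (1 / 16) δ m B) :
    2 ^ n * (1 - δ) ≤ 1 + 8 * (m * (1 / τ ^ 2)) := by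
  classical
  have h1 : ∀ s : Bits n, ENNReal.ofReal (1 - δ) ≤
      ∑' A, B A * if IsLawOfSamplesNear (1 / 16) (parityDist n s)
        (A.outputLaw (maskedTable 𝓜 τ (parityState n s)) m []) then (1 : ℝ≥0∞) else 0 := by
    intro s
    have h := hB (parityCircuit n s) ⟨s, rfl⟩ (maskedTable 𝓜 τ (parityState n s))
      (by rw [outputState_parityCircuit]; exact isAccurate_maskedTable 𝓜 hτ _)
    rw [outputState_parityCircuit, basisDist_parityState, PMF.toOuterMeasure_apply] at h
    refine h.trans (le_of_eq (tsum_congr fun A => ?_))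
    simp [Set.indicator_apply]
  have h2 : (2 : ℝ≥0∞) ^ n * ENNReal.ofReal (1 - δ) ≤
      1 + 8 * (m * ENNReal.ofReal (1 / τ ^ 2)) := by
    calc (2 : ℝ≥0∞) ^ n * ENNReal.ofReal (1 - δ) = ∑ _s : Bits n, ENNReal.ofReal (1 - δ) := by
          simp
      _ ≤ _ := Finset.sum_le_sum fun s _ => h1 s
      _ = ∑' A, ∑ s : Bits n, B A * if IsLawOfSamplesNear (1 / 16) (parityDist n s)
            (A.outputLaw (maskedTable 𝓜 τ (parityState n s)) m []) then (1 : ℝ≥0∞) else 0 :=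
          (Summable.tsum_finsetSum fun _ _ => ENNReal.summable).symm
      _ ≤ ∑' A, B A * (1 + 8 * (m * ENNReal.ofReal (1 / τ ^ 2))) := by
          refine ENNReal.tsum_le_tsum fun A => ?_
          rw [← Finset.mul_sum]
          gcongr
          exact sum_success_le hk hτ h𝓜 A
      _ = _ := by rw [ENNReal.tsum_mul_right, B.tsum_coe, one_mul]
  have h3 := ENNReal.toReal_mono (by finiteness) h2
  rw [ENNReal.toReal_add (by finiteness) (by finiteness)] at h3
  simpa [ENNReal.toReal_mul, ENNReal.toReal_ofReal (sub_nonneg.mpr hδ.le),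
    ENNReal.toReal_ofReal (inv_nonneg.mpr (sq_nonneg τ))] using h3

end WeakToStrong

theorem mainTheorem4 :
    ∃ C : ∀ n : ℕ, Bits n → CliffordCircuit (n + 1),
      (∀ (n : ℕ) (s : Bits n), outputState (C n s) = parityState n s ∧
        basisDist (outputState (C n s)) = parityDist n s) ∧
      ∀ (τ : ℕ → ℝ) (m k : ℕ → ℕ) (δ : ℝ) (𝓜 : ∀ n : ℕ, Set (Operator (n + 1))),
        (∀ n, 0 < τ n) → (∀ n, 1 ≤ k n) → δ < 1 →
        (∀ n, 𝓜 n ⊆ zBasisObservables (n + 1)) →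
        (fun n => (m n : ℝ)) =o[atTop] (fun n => τ n ^ 2 * 2 ^ n) →
        ∀ᶠ n in atTop, ¬ ∃ B : PMF (QueryAlgorithm (𝓜 n) (Fin (k n) → Bits (n + 1))),
          SamplesFromEstimates (Set.range (C n)) (τ n) (1 / 16) δ (m n) B := by
  refine ⟨parityCircuit, fun n s => ⟨outputState_parityCircuit n s, ?_⟩, ?_⟩
  · rw [outputState_parityCircuit, basisDist_parityState]
  · intro τ m k δ 𝓜 hτ hk hδ h𝓜 hm
    have hδ' : 0 < 1 - δ := sub_pos.mpr hδ
    have hlarge : ∀ᶠ n : ℕ in atTop, 2 / (1 - δ) < (2 : ℝ) ^ n :=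
      (tendsto_pow_atTop_atTop_of_one_lt one_lt_two).eventually_gt_atTop _
    -- The constant (1 - δ)/16 makes 8m/τ² at most half of 2^n (1 - δ), and `hlarge` makes 1 less
    -- than the other half.
    filter_upwards [hm.bound (div_pos hδ' (by norm_num : (0 : ℝ) < 16)), hlarge] with n hmn hn
    rintro ⟨B, hB⟩
    have hbound := hB.query_bound (hk n) (hτ n) hδ (h𝓜 n)
    have hτ2 : 0 < τ n ^ 2 := pow_pos (hτ n) 2
    rw [Real.norm_of_nonneg (Nat.cast_nonneg _), Real.norm_of_nonneg (by positivity)] at hmn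
    have h1 : (m n : ℝ) * (1 / τ n ^ 2) ≤ (1 - δ) / 16 * 2 ^ n := by
      rw [mul_one_div, div_le_iff₀ hτ2]
      linarith
    rw [div_lt_iff₀ hδ'] at hn
    linarith
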